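/- Let $T>0$, $I=(0,T)$, $d\in\mathbb N$ and $\beta>0$. Let $\mathcal C_0(I;\mathbb R^d)$ be the space of continuous functions on $I$ vanishing at the boundary, and for bounded $\varphi:I\to\mathbb R^d$ let $\|\varphi\|_{\mathcal C}=\sup_{t\in I}|\varphi(t)|$. Let $\mathcal M(I;\mathbb R^d)$ be the space of $\mathbb R^d$-valued Borel measures on $I$, with pairing $\langle\varphi,q\rangle=\int_I(\varphi(t),\mathrm dq(t))_{\mathbb R^d}$ and norm $\|q\|_{\mathcal M}=\sup\{\langle\varphi,q\rangle:\varphi\in\mathcal C_0(I;\mathbb R^d),\ \|\varphi\|_{\mathcal C}=1\}$. Let $\mathrm{BV}(I;\mathbb R^d)$ be the space of all $u\in L^1(I;\mathbb R^d)$ whose distributional derivative is a measure $u'\in\mathcal M(I;\mathbb R^d)$, i.e. $\int_I(u,\varphi')_{\mathbb R^d}\,\mathrm dt=-\langle\varphi,u'\rangle$ for all $\varphi\in\mathcal C_c^\infty(I;\mathbb R^d)$, with norm $\|u\|_{\mathrm{BV}}=\|u'\|_{\mathcal M}+\|u\|_{L^1}$; recall that $\mathrm{BV}(I;\mathbb R^d)\subset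 L^2(I;\mathbb R^d)$. Let $Y$ be a real Hilbert space, let $K:L^2(I;\mathbb R^d)\to Y$ be linear and continuous with adjoint $K^*$, and let $F:Y\to\mathbb R$ be strictly convex and continuously Fréchet differentiable, with gradient $\nabla F$ (the Riesz representative of $F'$). Consider $$\min_{u\in \mathrm{BV}(I;\mathbb R^d)} j(u),\qquad j(u)=F(Ku)+\beta\|u'\|_{\mathcal M},\tag{$\mathcal P$}$$ and assume that $j$ is radially unbounded, i.e. $j(u_k)\to+\infty$ whenever $\|u_k\|_{\mathrm{BV}}\to\infty$. **Theorem.** Let $\bar u\in\mathrm{BV}(I;\mathbb R^d)$ and set $$\bar p(t)=\int_0^t \big(K^*\nabla F(K\bar u)\big)(s)\,\mathrm ds,\qquad t\in[0,T].$$ Then $\bar p\in\mathcal C([0,T];\mathbb R^d)$, and $\bar u$ is a minimizer of $(\mathcal P)$ if and only if all of the following hold: 1. $\|\bar p\|_{\mathcal C}=\beta$ if $\bar u'\neq0$, and $\|\bar p\|_{\mathcal C}\le\beta$ if $\bar u'=0$; 2. $\bar p(T)=0$; 3. $\langle\bar p,\bar u'\rangle=\beta\|\bar u'\|_{\mathcal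 M}$. -/

import Mathlib

open MeasureTheory Set Filter Topology
open scoped ENNReal ContDiff ZeroAtInfty

namespace BVOpt

/-- The space `ℝ^d` with its Euclidean norm. -/
abbrev Vec (d : ℕ) : Type := EuclideanSpace ℝ (Fin d)

/-- Lebesgue measure on the interval `I = (0, T)`. -/
noncomputable abbrev leb (T : ℝ) : Measure ℝ := volume.restrict (Ioo 0 T)

/-- The space `L^1(I; ℝ^d)`. -/
noncomputable abbrev L1 (T : ℝ) (d : ℕ) := Lp (Vec d) 1 (leb T)

/-- The space `L^2(I; ℝ^d)`. -/
noncomputable abbrev L2 (T : ℝ) (d : ℕ) := Lp (Vec d) 2 (leb T)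

/-- The space `M(I; ℝ^d)` of (finite, hence regular) Borel vector measures on `I = (0, T)`. -/
abbrev Meas (T : ℝ) (d : ℕ) := VectorMeasure (Ioo (0 : ℝ) T) (Vec d)

/-- The duality pairing `⟨φ, q⟩ = ∫_I (φ(t), dq(t))` of a function on `I` with a vector measure. -/
noncomputable def pairing {T : ℝ} {d : ℕ} (φ : Ioo (0 : ℝ) T → Vec d) (q : Meas T d) : ℝ :=
  q.integral φ (innerSL ℝ)

/-- The dual norm `‖q‖_M = sup { ⟨φ, q⟩ : φ ∈ C_0(I; ℝ^d), ‖φ‖_C = 1 }`. -/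
noncomputable def mNorm {T : ℝ} {d : ℕ} (q : Meas T d) : ℝ :=
  sSup {r : ℝ | ∃ φ : C₀(Ioo (0 : ℝ) T, Vec d), ‖φ‖ = 1 ∧ r = pairing φ q}

/-- The sup norm `‖φ‖_C = sup_{t ∈ I} |φ(t)|`. -/
noncomputable def cNorm {d : ℕ} (T : ℝ) (φ : ℝ → Vec d) : ℝ :=
  ⨆ t : Ioo (0 : ℝ) T, ‖φ t‖

/-- The test functions `C_c^∞(I; ℝ^d)`. -/
structure IsTest {d : ℕ} (T : ℝ) (φ : ℝ → Vec d) : Prop where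
  contDiff : ContDiff ℝ ∞ φ
  hasCompactSupport : HasCompactSupport φ
  tsupport_subset : tsupport φ ⊆ Ioo 0 T

/-- The vector measure `q` is the distributional derivative of `u` on `I`. -/
def IsDistribDeriv {T : ℝ} {d : ℕ} (u : L1 T d) (q : Meas T d) : Prop :=
  ∀ φ : ℝ → Vec d, IsTest T φ →
    ∫ t in Ioo 0 T, inner ℝ (u t) (deriv φ t) = -pairing (fun t : Ioo (0 : ℝ) T => φ t) q

/-- The space `BV(I; ℝ^d)`: functions in `L^1(I; ℝ^d)` whose distributional derivative is a
vector measure. -/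
abbrev BV (T : ℝ) (d : ℕ) : Type := {u : L1 T d // ∃ q : Meas T d, IsDistribDeriv u q}

/-- The distributional derivative `u'` of a function of bounded variation. -/
noncomputable def BV.deriv {T : ℝ} {d : ℕ} (u : BV T d) : Meas T d := Classical.choose u.2

/-- The norm `‖u‖_BV = ‖u'‖_M + ‖u‖_{L^1}`. -/
noncomputable def BV.norm {T : ℝ} {d : ℕ} (u : BV T d) : ℝ := mNorm u.deriv + ‖u.1‖

theorem isFiniteMeasure_variation {T : ℝ} {d : ℕ} (q : Meas T d) :
    IsFiniteMeasure q.variation := by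
  let c : Fin d → SignedMeasure (Ioo (0 : ℝ) T) := fun i =>
    q.mapRange (EuclideanSpace.proj i : Vec d →L[ℝ] ℝ).toLinearMap.toAddMonoidHom
      (EuclideanSpace.proj i : Vec d →L[ℝ] ℝ).continuous
  have h : q.variation ≤ ∑ i, (c i).totalVariation := by
    apply VectorMeasure.variation_le_of_forall_enorm_le
    intro A hA
    have h1 : ‖q A‖ₑ ≤ ∑ i, ‖q A i‖ₑ := by
      have : q A = ∑ i, EuclideanSpace.single i (q A i) := by
        ext j
        simp
      conv_lhs => rw [this]
      refine (enorm_sum_le _ _).trans (Finset.sum_le_sum fun i _ => ?_)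
      rw [← ofReal_norm, ← ofReal_norm]
      simp
    refine h1.trans ?_
    rw [Measure.coe_finsetSum, Finset.sum_apply]
    refine Finset.sum_le_sum fun i _ => ?_
    rw [SignedMeasure.totalVariation_eq_variation]
    have hc : c i A = q A i := VectorMeasure.mapRange_apply _ _
    rw [← hc]
    exact VectorMeasure.enorm_measure_le_variation (c i) A
  have : IsFiniteMeasure (∑ i, (c i).totalVariation) := by
    constructor
    rw [Measure.coe_finsetSum, Finset.sum_apply]
    exact ENNReal.sum_lt_top.2 fun i _ => measure_lt_top _ _
  exact isFiniteMeasure_of_le _ h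

/-- A test function with mean zero is the derivative of a test function. -/
theorem exists_test_primitive {T : ℝ} (hT : 0 < T) {d : ℕ} {w : ℝ → Vec d} (hw : IsTest T w)
    (h0 : ∫ t in Ioo 0 T, w t = 0) :
    ∃ φ : ℝ → Vec d, IsTest T φ ∧ deriv φ = w ∧ ∀ t ∈ Ioo 0 T, ‖φ t‖ ≤ ∫ s in Ioo 0 T, ‖w s‖ := by
  have hwc : Continuous w := hw.contDiff.continuous
  obtain ⟨a, b, ha, hb, hab⟩ : ∃ a b, 0 < a ∧ b < T ∧ tsupport w ⊆ Icc a b := by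
    rcases (tsupport w).eq_empty_or_nonempty with h | h
    · exact ⟨T / 2, T / 2, by linarith, by linarith, by simp [h]⟩
    · have hK : IsCompact (tsupport w) := hw.hasCompactSupport
      exact ⟨sInf (tsupport w), sSup (tsupport w), (hw.tsupport_subset (hK.sInf_mem h)).1,
        (hw.tsupport_subset (hK.sSup_mem h)).2,
        fun x hx => ⟨csInf_le hK.bddBelow hx, le_csSup hK.bddAbove hx⟩⟩
  have hz : ∀ t, t ∉ Icc a b → w t = 0 := fun t ht =>
    image_eq_zero_of_notMem_tsupport fun h => ht (hab h)
  let φ : ℝ → Vec d := fun t => ∫ s in (0 : ℝ)..t, w s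
  have hd : ∀ t, HasDerivAt φ (w t) t := fun t =>
    intervalIntegral.integral_hasDerivAt_right (hwc.intervalIntegrable _ _)
      (hwc.stronglyMeasurableAtFilter _ _) hwc.continuousAt
  have hderiv : deriv φ = w := funext fun t => (hd t).deriv
  have hzero : ∀ t, t ∉ Icc a b → φ t = 0 := by
    intro t ht
    rw [mem_Icc, not_and_or, not_le, not_le] at ht
    rcases ht with ht | ht
    · have : EqOn w 0 (uIcc 0 t) := by
        intro s hs
        refine hz s fun hs' => ?_
        rcases le_total 0 t with h | h
        · rw [uIcc_of_le h] at hs; linarith [hs.2, hs'.1]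
        · rw [uIcc_of_ge h] at hs; linarith [hs.2, hs'.1]
      show ∫ s in (0 : ℝ)..t, w s = 0
      rw [intervalIntegral.integral_congr this]
      simp
    · have e1 : ∫ s in (0 : ℝ)..T, w s = 0 := by
        rw [intervalIntegral.integral_of_le hT.le, integral_Ioc_eq_integral_Ioo, h0]
      have e2 : ∫ s in t..T, w s = 0 := by
        have : EqOn w 0 (uIcc t T) := by
          intro s hs
          refine hz s fun hs' => ?_
          rcases le_total t T with h | h
          · rw [uIcc_of_le h] at hs; linarith [hs.1, hs'.2]
          · rw [uIcc_of_ge h] at hs; linarith [hs.1, hs'.2]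
        rw [intervalIntegral.integral_congr this]
        simp
      have := intervalIntegral.integral_add_adjacent_intervals (μ := volume)
        (hwc.intervalIntegrable 0 t) (hwc.intervalIntegrable t T)
      rw [e1, e2, add_zero] at this
      exact this
  have hts : tsupport φ ⊆ Icc a b :=
    closure_minimal (fun t ht => by_contra fun h => ht (hzero t h)) isClosed_Icc
  refine ⟨φ, ⟨?_, ?_, ?_⟩, hderiv, ?_⟩
  · rw [contDiff_infty_iff_deriv, hderiv]
    exact ⟨fun t => (hd t).differentiableAt, hw.contDiff⟩
  · exact isCompact_Icc.of_isClosed_subset (isClosed_tsupport _) hts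
  · exact hts.trans fun t ht => ⟨ha.trans_le ht.1, ht.2.trans_lt hb⟩
  · intro t ht
    show ‖∫ s in (0 : ℝ)..t, w s‖ ≤ _
    rw [intervalIntegral.integral_of_le ht.1.le]
    refine (norm_integral_le_integral_norm _).trans ?_
    refine setIntegral_mono_set ?_ ?_ ?_
    · exact (hwc.norm.integrableOn_Icc (a := 0) (b := T)).mono_set Ioo_subset_Icc_self
    · exact ae_of_all _ fun s => norm_nonneg _
    · exact (show Ioc 0 t ⊆ Ioo 0 T from fun s hs => ⟨hs.1, hs.2.trans_lt ht.2⟩).eventuallyLE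

/-- The distributional derivative controls `u` in the dual of `L^1`, hence of `L^2`. -/
theorem exists_test_bound {T : ℝ} (hT : 0 < T) {d : ℕ} {u : L1 T d} {q : Meas T d}
    (h : IsDistribDeriv u q) :
    ∃ C : ℝ, 0 ≤ C ∧ ∀ ψ : ℝ → Vec d, IsTest T ψ →
      |∫ t in Ioo 0 T, inner ℝ (u t) (ψ t)| ≤ C * ∫ t in Ioo 0 T, ‖ψ t‖ := by
  have := isFiniteMeasure_variation q
  let ρb : ContDiffBump (T / 2) := ⟨T / 8, T / 4, by linarith, by linarith⟩
  let ρ : ℝ → ℝ := ρb.normed volume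
  have hρsup : tsupport ρ ⊆ Ioo 0 T := by
    rw [ρb.tsupport_normed_eq, Real.closedBall_eq_Icc]
    intro t ht
    have h1 : T / 2 - T / 4 ≤ t := ht.1
    have h2 : t ≤ T / 2 + T / 4 := ht.2
    exact ⟨by linarith, by linarith⟩
  have hρd : ContDiff ℝ ∞ ρ := ρb.contDiff_normed
  have hρ1 : ∫ t in Ioo 0 T, ρ t = 1 := by
    rw [setIntegral_eq_integral_of_forall_compl_eq_zero, ρb.integral_normed]
    exact fun t ht => image_eq_zero_of_notMem_tsupport fun h => ht (hρsup h)
  have hint : ∀ f : ℝ → Vec d, Continuous f → IntegrableOn f (Ioo 0 T) := fun f hf =>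
    (hf.integrableOn_Icc (a := 0) (b := T)).mono_set Ioo_subset_Icc_self
  have hρint : IntegrableOn ρ (Ioo 0 T) :=
    (hρd.continuous.integrableOn_Icc (a := 0) (b := T)).mono_set Ioo_subset_Icc_self
  have hu : Integrable u (leb T) := L1.integrable_coeFn u
  let R : ℝ := ∫ t in Ioo 0 T, ‖ρ t‖
  have hR : 0 ≤ R := integral_nonneg fun t => norm_nonneg _
  let v : Vec d := ∫ t in Ioo 0 T, ρ t • u t
  let V : ℝ := ‖innerSL ℝ (E := Vec d)‖ * q.variation.real univ
  have hV : 0 ≤ V := mul_nonneg (norm_nonneg (innerSL ℝ (E := Vec d))) measureReal_nonneg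
  refine ⟨(1 + R) * V + ‖v‖, by positivity, fun ψ hψ => ?_⟩
  have hψc : Continuous ψ := hψ.contDiff.continuous
  let m : Vec d := ∫ t in Ioo 0 T, ψ t
  let N : ℝ := ∫ t in Ioo 0 T, ‖ψ t‖
  have hN : 0 ≤ N := integral_nonneg fun t => norm_nonneg _
  have hm : ‖m‖ ≤ N := norm_integral_le_integral_norm _
  let w : ℝ → Vec d := fun t => ψ t - ρ t • m
  have hwt : IsTest T w := by
    have hsub : tsupport w ⊆ tsupport ψ ∪ tsupport ρ := by
      refine closure_minimal (fun t ht => ?_) ((isClosed_tsupport _).union (isClosed_tsupport _))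
      by_contra hn
      rw [mem_union, not_or] at hn
      exact ht (by simp [w, image_eq_zero_of_notMem_tsupport hn.1,
        image_eq_zero_of_notMem_tsupport hn.2])
    refine ⟨hψ.contDiff.sub (hρd.smul contDiff_const), ?_, ?_⟩
    · exact (hψ.hasCompactSupport.isCompact.union ρb.hasCompactSupport_normed.isCompact).of_isClosed_subset
        (isClosed_tsupport _) hsub
    · exact hsub.trans (union_subset hψ.tsupport_subset hρsup)
  have hw0 : ∫ t in Ioo 0 T, w t = 0 := by
    show ∫ t in Ioo 0 T, (ψ t - ρ t • m) = 0
    rw [integral_sub (hint ψ hψc) (hρint.smul_const m), integral_smul_const, hρ1, one_smul, sub_self]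
  have hwN : ∫ t in Ioo 0 T, ‖w t‖ ≤ (1 + R) * N := by
    calc ∫ t in Ioo 0 T, ‖w t‖ ≤ ∫ t in Ioo 0 T, (‖ψ t‖ + ‖ρ t‖ * ‖m‖) := by
          refine integral_mono (hint w hwt.contDiff.continuous).norm
            ((hint ψ hψc).norm.add (hρint.norm.mul_const _)) fun t => ?_
          exact (norm_sub_le _ _).trans (by rw [norm_smul])
      _ = N + R * ‖m‖ := by
          rw [integral_add (hint ψ hψc).norm (hρint.norm.mul_const _), integral_mul_const]
      _ ≤ (1 + R) * N := by nlinarith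
  obtain ⟨φ, hφ, hφw, hφb⟩ := exists_test_primitive hT hwt hw0
  have hb : |pairing (fun t : Ioo (0 : ℝ) T => φ t) q| ≤ (1 + R) * N * V := by
    have := VectorMeasure.norm_integral_le_of_norm_le_const (μ := q) (B := innerSL ℝ)
      (f := fun t : Ioo (0 : ℝ) T => φ t) (C := (1 + R) * N)
      (ae_of_all _ fun t => (hφb t t.2).trans hwN)
    rw [mul_assoc] at this
    exact this
  have hsplit : ∫ t in Ioo 0 T, inner ℝ (u t) (ψ t) =
      (∫ t in Ioo 0 T, inner ℝ (u t) (deriv φ t)) + inner ℝ v m := by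
    have hρb : ∃ c, ∀ t, ‖ρ t‖ ≤ c :=
      hρd.continuous.bounded_above_of_compact_support ρb.hasCompactSupport_normed
    have hwb : ∃ c, ∀ t, ‖w t‖ ≤ c :=
      hwt.contDiff.continuous.bounded_above_of_compact_support hwt.hasCompactSupport
    obtain ⟨c, hc⟩ := hρb
    obtain ⟨c', hc'⟩ := hwb
    have i1 : Integrable (fun t => ρ t • u t) (leb T) :=
      hu.bdd_smul c hρd.continuous.aestronglyMeasurable (ae_of_all _ hc)
    have i2 : Integrable (fun t => inner ℝ (u t) (w t)) (leb T) := by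
      refine (hu.norm.mul_const c').mono'
        (hu.aestronglyMeasurable.inner hwt.contDiff.continuous.aestronglyMeasurable)
        (ae_of_all _ fun t => (norm_inner_le_norm _ _).trans ?_)
      gcongr
      exact hc' t
    have e : inner ℝ v m = ∫ t in Ioo 0 T, inner ℝ (ρ t • u t) m := by
      rw [real_inner_comm, ← integral_inner i1 m]
      simp_rw [real_inner_comm]
    rw [e, hφw, ← integral_add i2 (i1.inner_const m)]
    refine integral_congr_ae (ae_of_all _ fun t => ?_)
    simp only [w, inner_sub_right, real_inner_smul_left, real_inner_smul_right]
    ring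
  rw [hsplit, h φ hφ]
  calc |-pairing (fun t : Ioo (0 : ℝ) T => φ t) q + inner ℝ v m|
      ≤ |pairing (fun t : Ioo (0 : ℝ) T => φ t) q| + ‖v‖ * ‖m‖ := by
        refine (abs_add_le _ _).trans ?_
        rw [abs_neg]
        gcongr
        exact abs_real_inner_le_norm _ _
    _ ≤ (1 + R) * N * V + ‖v‖ * N := by gcongr
    _ = ((1 + R) * V + ‖v‖) * N := by ring

/-- The embedding of `BV(I; ℝ^d)` into `L^2(I; ℝ^d)`. -/
theorem BV.memLp_two {T : ℝ} {d : ℕ} (u : BV T d) : MemLp (u.1 : ℝ → Vec d) 2 (leb T) := by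
  rcases le_or_gt T 0 with hT | hT
  · have : leb T = 0 := by simp [leb, Ioo_eq_empty hT.not_gt]
    have h0 : ∀ f : ℝ → Vec d, MemLp f 2 (leb T) := by
      rw [this]
      simp
    exact h0 _
  obtain ⟨q, hq⟩ := u.2
  obtain ⟨C, hC0, hC⟩ := exists_test_bound hT hq
  have hu : Integrable u.1 (leb T) := L1.integrable_coeFn u.1
  have htb : ∀ ψ : ℝ → Vec d, IsTest T ψ → ∃ c, ∀ t, ‖ψ t‖ ≤ c := fun ψ hψ =>
    hψ.contDiff.continuous.bounded_above_of_compact_support hψ.hasCompactSupport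
  let S : Submodule ℝ (L2 T d) :=
    { carrier := {x | ∃ ψ, IsTest T ψ ∧ x =ᵐ[leb T] ψ}
      zero_mem' := ⟨0, ⟨contDiff_const, HasCompactSupport.zero, by simp [tsupport]⟩,
        Lp.coeFn_zero _ _ _⟩
      add_mem' := by
        rintro x y ⟨f, hf, hxf⟩ ⟨g, hg, hyg⟩
        refine ⟨f + g, ⟨hf.contDiff.add hg.contDiff, hf.hasCompactSupport.add hg.hasCompactSupport,
          (tsupport_add f g).trans (union_subset hf.tsupport_subset hg.tsupport_subset)⟩, ?_⟩
        exact (Lp.coeFn_add x y).trans (hxf.add hyg)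
      smul_mem' := by
        rintro c x ⟨f, hf, hxf⟩
        have hs : tsupport (c • f) ⊆ tsupport f :=
          closure_mono (Function.support_const_smul_subset c f)
        refine ⟨c • f, ⟨contDiff_const.smul hf.contDiff, ?_, hs.trans hf.tsupport_subset⟩, ?_⟩
        · exact hf.hasCompactSupport.isCompact.of_isClosed_subset (isClosed_tsupport _) hs
        · exact (Lp.coeFn_smul c x).trans (hxf.const_smul c) }
  have hintg : ∀ x : S, Integrable (fun t => inner ℝ (u.1 t) ((x : L2 T d) t)) (leb T) := by
    rintro ⟨x, ψ, hψ, hx⟩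
    obtain ⟨c, hc⟩ := htb ψ hψ
    refine (hu.norm.mul_const c).mono'
      (hu.aestronglyMeasurable.inner (Lp.aestronglyMeasurable x)) ?_
    filter_upwards [hx] with t ht
    refine (norm_inner_le_norm _ _).trans ?_
    show ‖u.1 t‖ * ‖x t‖ ≤ _
    rw [ht]
    gcongr
    exact hc t
  let ℓ₀ : S →ₗ[ℝ] ℝ :=
    { toFun := fun x => ∫ t in Ioo 0 T, inner ℝ (u.1 t) ((x : L2 T d) t)
      map_add' := by
        intro x y
        rw [← integral_add (hintg x) (hintg y)]
        refine integral_congr_ae ?_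
        filter_upwards [Lp.coeFn_add (x : L2 T d) (y : L2 T d)] with t ht
        show inner ℝ (u.1 t) (((x : L2 T d) + (y : L2 T d)) t) = _
        rw [ht, Pi.add_apply, inner_add_right]
      map_smul' := by
        intro c x
        rw [RingHom.id_apply, smul_eq_mul, ← integral_const_mul]
        refine integral_congr_ae ?_
        filter_upwards [Lp.coeFn_smul c (x : L2 T d)] with t ht
        show inner ℝ (u.1 t) ((c • (x : L2 T d)) t) = _
        rw [ht, Pi.smul_apply, real_inner_smul_right] }
  obtain ⟨c₁, hc₁⟩ : ∃ c₁ : ℝ, ∀ x : L2 T d, ∫ t in Ioo 0 T, ‖x t‖ ≤ c₁ * ‖x‖ := by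
    refine ⟨(volume (Ioo 0 T) ^ ((1 : ℝ) / (1 : ℝ≥0∞).toReal - 1 / (2 : ℝ≥0∞).toReal)).toReal,
      fun x => ?_⟩
    have h1 := eLpNorm_le_eLpNorm_mul_rpow_measure_univ (p := 1) (q := 2) (μ := leb T)
      (by norm_num) (Lp.aestronglyMeasurable x)
    rw [Measure.restrict_apply_univ] at h1
    have h2 := ENNReal.toReal_mono ?_ h1
    · rw [ENNReal.toReal_mul, ← Lp.norm_def, mul_comm] at h2
      refine le_trans (le_of_eq ?_) h2
      rw [eLpNorm_one_eq_lintegral_enorm]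
      exact integral_norm_eq_lintegral_enorm (Lp.aestronglyMeasurable x)
    · refine ENNReal.mul_ne_top (Lp.eLpNorm_ne_top x) ?_
      refine ENNReal.rpow_ne_top_of_nonneg ?_ ?_
      · norm_num
      · simp
  have hbd : ∀ x : S, ‖ℓ₀ x‖ ≤ C * c₁ * ‖x‖ := by
    intro x
    obtain ⟨ψ, hψ, hx⟩ := x.2
    have e1 : ℓ₀ x = ∫ t in Ioo 0 T, inner ℝ (u.1 t) (ψ t) := by
      refine integral_congr_ae ?_
      filter_upwards [hx] with t ht
      rw [ht]
    have e2 : ∫ t in Ioo 0 T, ‖ψ t‖ = ∫ t in Ioo 0 T, ‖(x : L2 T d) t‖ := by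
      refine integral_congr_ae ?_
      filter_upwards [hx] with t ht
      rw [ht]
    rw [e1, Real.norm_eq_abs, mul_assoc]
    refine (hC ψ hψ).trans ?_
    rw [e2]
    exact mul_le_mul_of_nonneg_left (hc₁ x) hC0
  obtain ⟨ℓ, hℓ, -⟩ := exists_extension_norm_eq S (ℓ₀.mkContinuous _ hbd)
  let h : L2 T d := (InnerProductSpace.toDual ℝ (L2 T d)).symm ℓ
  have hh : ∀ x : L2 T d, inner ℝ h x = ℓ x := fun x =>
    InnerProductSpace.toDual_symm_apply
  have hhi : Integrable h (leb T) := (Lp.memLp h).integrable (by norm_num)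
  have key : ∀ ψ : ℝ → Vec d, IsTest T ψ →
      ∫ t in Ioo 0 T, inner ℝ (u.1 t) (ψ t) = ∫ t in Ioo 0 T, inner ℝ (h t) (ψ t) := by
    intro ψ hψ
    obtain ⟨c, hc⟩ := htb ψ hψ
    have hmem : MemLp ψ 2 (leb T) :=
      MemLp.of_bound hψ.contDiff.continuous.aestronglyMeasurable c (ae_of_all _ hc)
    have hx : hmem.toLp ψ =ᵐ[leb T] ψ := hmem.coeFn_toLp
    have h1 := hℓ ⟨hmem.toLp ψ, ψ, hψ, hx⟩
    have h2 := hh (hmem.toLp ψ)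
    rw [L2.inner_def, h1] at h2
    have e1 : ∫ t in Ioo 0 T, inner ℝ (h t) (ψ t) =
        ∫ t in Ioo 0 T, inner ℝ (h t) (hmem.toLp ψ t) := by
      refine integral_congr_ae ?_
      filter_upwards [hx] with t ht
      rw [ht]
    have e2 : ∫ t in Ioo 0 T, inner ℝ (u.1 t) (ψ t) =
        ∫ t in Ioo 0 T, inner ℝ (u.1 t) (hmem.toLp ψ t) := by
      refine integral_congr_ae ?_
      filter_upwards [hx] with t ht
      rw [ht]
    rw [e1, e2]
    exact h2.symm
  have hae : ∀ᵐ t ∂(leb T), t ∈ Ioo 0 T → (u.1 t - h t) = 0 := by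
    refine isOpen_Ioo.ae_eq_zero_of_integral_contDiff_smul_eq_zero
      (f := fun t => u.1 t - h t) ((hu.sub hhi).locallyIntegrable.locallyIntegrableOn _) ?_
    intro g hg hgc hgs
    obtain ⟨c, hc⟩ := hg.continuous.bounded_above_of_compact_support hgc
    have i : ∀ f : ℝ → Vec d, Integrable f (leb T) → Integrable (fun t => g t • f t) (leb T) :=
      fun f hf => hf.bdd_smul c hg.continuous.aestronglyMeasurable (ae_of_all _ hc)
    refine ext_inner_left ℝ fun v => ?_
    have hs : tsupport (fun t => g t • v) ⊆ tsupport g :=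
      closure_mono (Function.support_smul_subset_left g fun _ => v)
    have ht : IsTest T (fun t => g t • v) :=
      ⟨hg.smul contDiff_const,
        hgc.isCompact.of_isClosed_subset (isClosed_tsupport _) hs, hs.trans hgs⟩
    have k := key _ ht
    have sw : ∀ f : ℝ → Vec d, Integrable f (leb T) →
        ∫ t in Ioo 0 T, inner ℝ (f t) (g t • v) = inner ℝ v (∫ t in Ioo 0 T, g t • f t) := by
      intro f hf
      rw [← integral_inner (i f hf) v]
      refine integral_congr_ae (ae_of_all _ fun t => ?_)
      simp only [real_inner_smul_right, real_inner_comm]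
    rw [sw _ hu, sw _ hhi] at k
    simp_rw [smul_sub]
    rw [integral_sub (i _ hu) (i _ hhi), inner_sub_right, k, sub_self, inner_zero_right]
  refine (Lp.memLp h).ae_eq ?_
  filter_upwards [hae, ae_restrict_mem measurableSet_Ioo] with t h1 h2
  exact (sub_eq_zero.1 (h1 h2)).symm

/-- A function of bounded variation as an element of `L^2(I; ℝ^d)`. -/
noncomputable def BV.toL2 {T : ℝ} {d : ℕ} (u : BV T d) : L2 T d := u.memLp_two.toLp u.1

section Problem

variable {Y : Type*} [NormedAddCommGroup Y] [InnerProductSpace ℝ Y]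

/-- The objective functional `j(u) = F(K u) + β ‖u'‖_M` on `BV(I; ℝ^d)`. -/
noncomputable def objective {T : ℝ} {d : ℕ} (K : L2 T d →L[ℝ] Y) (F : Y → ℝ) (β : ℝ)
    (u : BV T d) : ℝ :=
  F (K u.toL2) + β * mNorm u.deriv

/-- The dual variable `p(t) = ∫_0^t K^* ∇F(K u)(s) ds`. -/
noncomputable def dualVar [CompleteSpace Y] {T : ℝ} {d : ℕ} (K : L2 T d →L[ℝ] Y) (F : Y → ℝ)
    (u : BV T d) (t : ℝ) : Vec d :=
  ∫ s in (0 : ℝ)..t, (ContinuousLinearMap.adjoint K (gradient F (K u.toL2))) s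

end Problem

end BVOpt

namespace BVOpt

/-! The problem is convex, so minimality amounts to a first-order condition. Write `g = K^* ∇F(K u)`
and let `p` be its primitive vanishing at `0`. Once `p(T) = 0`, integration by parts
(`inner_toL2_eq_neg_pairing`) gives `(v, g) = -⟨p, v'⟩` for every `v` in BV. It extends the
definition of `v'` from test functions by density: derivatives of test functions are dense among the
mean-zero functions of `L²`, since only constants are orthogonal to all of them.

Sufficiency: the tangent inequality for `F` gives `F(Kv) ≥ F(Ku) - ⟨p, v'⟩ + ⟨p, u'⟩`. Since `p`
lies in `C₀` with norm at most `β`, `⟨p, v'⟩ ≤ β ‖v'‖`, and `⟨p, u'⟩ = β ‖u'‖` closes the estimate.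

Necessity: the variational inequality `inner_add_nonneg_of_isMinOn` is tested with well-chosen
directions. The constant `-p(T)` forces `p(T) = 0`; a step with jump `p(s)` at `s` forces `|p(s)| ≤
β`; the directions `u` and `-u` force `⟨p, u'⟩ = β ‖u'‖`. If `u' ≠ 0`, the last identity and `⟨p,
u'⟩ ≤ ‖p‖ ‖u'‖` give `‖p‖ ≥ β`. -/

variable {T : ℝ} {d : ℕ}

-- The pairing and the dual norm of a vector measure.

attribute [local instance] isFiniteMeasure_variation

theorem integrable_variation (q : Meas T d) {φ : Ioo (0 : ℝ) T → Vec d} (hφ : Continuous φ)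
    {C : ℝ} (hC : ∀ t, ‖φ t‖ ≤ C) : q.Integrable φ :=
  Integrable.of_bound hφ.aestronglyMeasurable C (ae_of_all _ hC)

theorem integrable_C0 (q : Meas T d) (φ : C₀(Ioo (0 : ℝ) T, Vec d)) : q.Integrable φ :=
  integrable_variation q φ.continuous fun t => φ.toBCF.norm_coe_le_norm t

theorem pairing_sub {q : Meas T d} {φ ψ : Ioo (0 : ℝ) T → Vec d} (hφ : q.Integrable φ)
    (hψ : q.Integrable ψ) : pairing (fun t => φ t - ψ t) q = pairing φ q - pairing ψ q :=
  VectorMeasure.integral_fun_sub hφ hψ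

theorem pairing_smul (q : Meas T d) (c : ℝ) (φ : Ioo (0 : ℝ) T → Vec d) :
    pairing (fun t => c • φ t) q = c * pairing φ q :=
  VectorMeasure.integral_fun_smul q (innerSL ℝ) c φ

theorem pairing_add_smul {q r : Meas T d} {φ : Ioo (0 : ℝ) T → Vec d} (c : ℝ)
    (hq : q.Integrable φ) (hr : r.Integrable φ) :
    pairing φ (q + c • r) = pairing φ q + c * pairing φ r := by
  unfold pairing
  rw [VectorMeasure.integral_add_vectorMeasure hq (hr.smul_vectorMeasure c),
    VectorMeasure.integral_smul_vectorMeasure, smul_eq_mul]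

/-- A crude bound for approximation and continuity arguments, where only the finiteness of the
constant matters; the sharp estimate is `pairing_le`. -/
theorem abs_pairing_le_integral (φ : Ioo (0 : ℝ) T → Vec d) (q : Meas T d) :
    |pairing φ q| ≤ ‖innerSL ℝ (E := Vec d)‖ * ∫ t, ‖φ t‖ ∂q.variation :=
  VectorMeasure.norm_integral_le_integral_norm (μ := q) (B := innerSL ℝ) (f := φ)

theorem abs_pairing_le {φ : Ioo (0 : ℝ) T → Vec d} {C : ℝ} (hC : ∀ t, ‖φ t‖ ≤ C) (q : Meas T d) :
    |pairing φ q| ≤ C * (‖innerSL ℝ (E := Vec d)‖ * q.variation.real univ) := by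
  have := VectorMeasure.norm_integral_le_of_norm_le_const (μ := q) (B := innerSL ℝ)
    (f := φ) (C := C) (ae_of_all _ hC)
  rwa [mul_assoc] at this

theorem norm_C0_le {φ : C₀(Ioo (0 : ℝ) T, Vec d)} {C : ℝ} (hC : 0 ≤ C) (h : ∀ t, ‖φ t‖ ≤ C) :
    ‖φ‖ ≤ C := by
  rw [← ZeroAtInftyContinuousMap.norm_toBCF_eq_norm]
  exact (BoundedContinuousFunction.norm_le hC).2 h

theorem norm_C0_apply_le (φ : C₀(Ioo (0 : ℝ) T, Vec d)) (t : Ioo (0 : ℝ) T) : ‖φ t‖ ≤ ‖φ‖ :=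
  φ.toBCF.norm_coe_le_norm t

theorem bddAbove_pairing (q : Meas T d) :
    BddAbove {r : ℝ | ∃ φ : C₀(Ioo (0 : ℝ) T, Vec d), ‖φ‖ = 1 ∧ r = pairing φ q} := by
  refine ⟨1 * (‖innerSL ℝ (E := Vec d)‖ * q.variation.real univ), ?_⟩
  rintro r ⟨φ, hφ, rfl⟩
  exact (le_abs_self _).trans (abs_pairing_le (fun t => hφ ▸ norm_C0_apply_le φ t) q)

theorem mNorm_le {q : Meas T d} {C : ℝ} (hC : 0 ≤ C)
    (h : ∀ φ : C₀(Ioo (0 : ℝ) T, Vec d), ‖φ‖ = 1 → pairing φ q ≤ C) : mNorm q ≤ C := by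
  refine Real.sSup_le ?_ hC
  rintro r ⟨φ, hφ, rfl⟩
  exact h φ hφ

theorem pairing_le_of_norm_eq_one {φ : C₀(Ioo (0 : ℝ) T, Vec d)} (hφ : ‖φ‖ = 1) (q : Meas T d) :
    pairing φ q ≤ mNorm q :=
  le_csSup (bddAbove_pairing q) ⟨φ, hφ, rfl⟩

theorem pairing_le (φ : C₀(Ioo (0 : ℝ) T, Vec d)) (q : Meas T d) :
    pairing φ q ≤ ‖φ‖ * mNorm q := by
  rcases eq_or_ne φ 0 with rfl | hφ
  · have : pairing (0 : C₀(Ioo (0 : ℝ) T, Vec d)) q = 0 := VectorMeasure.integral_zero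
    rw [this]
    simp
  have hn : 0 < ‖φ‖ := norm_pos_iff.2 hφ
  have h1 : ‖‖φ‖⁻¹ • φ‖ = 1 := by rw [norm_smul, norm_inv, norm_norm, inv_mul_cancel₀ hn.ne']
  have h2 := pairing_le_of_norm_eq_one h1 q
  have h3 : pairing (‖φ‖⁻¹ • φ : C₀(Ioo (0 : ℝ) T, Vec d)) q = ‖φ‖⁻¹ * pairing φ q :=
    pairing_smul q _ φ
  rwa [h3, inv_mul_le_iff₀ hn] at h2

theorem mNorm_nonneg (q : Meas T d) : 0 ≤ mNorm q := by
  by_cases h : ∃ φ : C₀(Ioo (0 : ℝ) T, Vec d), ‖φ‖ = 1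
  · obtain ⟨φ, hφ⟩ := h
    have h1 := pairing_le_of_norm_eq_one hφ q
    have h2 := pairing_le_of_norm_eq_one (φ := (-1 : ℝ) • φ) (by rw [norm_smul, hφ]; norm_num) q
    have h3 : pairing ((-1 : ℝ) • φ : C₀(Ioo (0 : ℝ) T, Vec d)) q = (-1) * pairing φ q :=
      pairing_smul q _ φ
    linarith
  -- Without functions of norm one (for instance when `d = 0`) the supremum is over the empty set
  -- and equals `0`.
  · refine Real.sSup_nonneg ?_
    rintro r ⟨φ, hφ, -⟩
    exact absurd ⟨φ, hφ⟩ h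

theorem mNorm_zero : mNorm (0 : Meas T d) = 0 :=
  (mNorm_le le_rfl fun _ _ => VectorMeasure.integral_zero_vectorMeasure.le).antisymm
    (mNorm_nonneg 0)

theorem mNorm_add_smul_le (q r : Meas T d) {c : ℝ} (hc : 0 ≤ c) :
    mNorm (q + c • r) ≤ mNorm q + c * mNorm r := by
  refine mNorm_le (add_nonneg (mNorm_nonneg q) (mul_nonneg hc (mNorm_nonneg r))) fun φ hφ => ?_
  rw [pairing_add_smul c (integrable_C0 q φ) (integrable_C0 r φ)]
  exact add_le_add (pairing_le_of_norm_eq_one hφ q)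
    (mul_le_mul_of_nonneg_left (pairing_le_of_norm_eq_one hφ r) hc)

/-- Since `q + (-2) • q` is `-q`, the left side is the norm of `(1 - c) q`, and `c ≤ 1` keeps the
factor nonnegative. The shape matches the derivative of `u.addSmul (-2) u`. -/
theorem mNorm_add_smul_reflection_le (q : Meas T d) {c : ℝ} (hc : c ≤ 1) :
    mNorm (q + c • (q + (-2 : ℝ) • q)) ≤ mNorm q + c * -mNorm q := by
  have h0 := mNorm_nonneg q
  refine mNorm_le (by nlinarith) fun φ hφ => ?_
  rw [pairing_add_smul _ (integrable_C0 q φ) (integrable_C0 _ φ),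
    pairing_add_smul _ (integrable_C0 q φ) (integrable_C0 q φ)]
  nlinarith [pairing_le_of_norm_eq_one hφ q]

theorem pairing_dirac (φ : Ioo (0 : ℝ) T → Vec d) (s : Ioo (0 : ℝ) T) (e : Vec d) :
    pairing φ (VectorMeasure.dirac s e : Meas T d) = inner ℝ (φ s) e :=
  VectorMeasure.integral_dirac

theorem mNorm_dirac_le (s : Ioo (0 : ℝ) T) (e : Vec d) :
    mNorm (VectorMeasure.dirac s e : Meas T d) ≤ ‖e‖ := by
  refine mNorm_le (norm_nonneg _) fun φ hφ => ?_
  rw [pairing_dirac]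
  refine (real_inner_le_norm _ _).trans ?_
  have : ‖φ s‖ ≤ 1 := hφ ▸ norm_C0_apply_le φ s
  nlinarith [norm_nonneg e]

/-! ### Measures are determined by `C₀` functions and by test functions. -/

theorem pairing_indicator (q : Meas T d) {A : Set (Ioo (0 : ℝ) T)} (hA : MeasurableSet A)
    (v : Vec d) : pairing (A.indicator fun _ => v) q = inner ℝ v (q A) := by
  unfold pairing
  rw [VectorMeasure.integral_eq_setToFun]
  exact setToFun_indicator_const _ hA (measure_ne_top _ _) v

/-- A vector measure that annihilates `C₀` vanishes. -/
theorem eq_zero_of_pairing_eq_zero {q : Meas T d}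
    (h : ∀ φ : C₀(Ioo (0 : ℝ) T, Vec d), pairing φ q = 0) : q = 0 := by
  ext A hA : 1
  have : LocallyCompactSpace (Ioo (0 : ℝ) T) := isOpen_Ioo.locallyCompactSpace
  -- With this `v`, pairing `q` with the indicator of `A` times `v` gives `‖q A‖ ^ 2`; the indicator
  -- is then approximated in `L¹` of the variation by compactly supported continuous functions,
  -- which pair to zero.
  set v := q A with hv
  have hf : q.Integrable (A.indicator fun _ => v) := (integrable_const v).indicator hA
  have key : ∀ ε > 0, ‖v‖ ^ 2 ≤ ‖innerSL ℝ (E := Vec d)‖ * ε := by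
    intro ε hε
    obtain ⟨g, hgs, hge, hgc, hgi⟩ := Integrable.exists_hasCompactSupport_integral_sub_le hf hε
    have hg0 : pairing g q = 0 :=
      h ⟨⟨g, hgc⟩, hgs.is_zero_at_infty⟩
    have h1 := abs_pairing_le_integral (fun t => A.indicator (fun _ => v) t - g t) q
    rw [pairing_sub hf hgi, hg0, sub_zero, pairing_indicator q hA, ← hv,
      real_inner_self_eq_norm_sq, abs_of_nonneg (by positivity)] at h1
    exact h1.trans (mul_le_mul_of_nonneg_left hge (norm_nonneg (innerSL ℝ (E := Vec d))))
  have h0 : ‖v‖ ^ 2 ≤ 0 := by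
    have ht : Tendsto (fun ε : ℝ => ‖innerSL ℝ (E := Vec d)‖ * ε) (𝓝[>] 0) (𝓝 0) := by
      have : Continuous fun ε : ℝ => ‖innerSL ℝ (E := Vec d)‖ * ε := by fun_prop
      simpa using (this.tendsto 0).mono_left nhdsWithin_le_nhds
    exact ge_of_tendsto ht (eventually_mem_nhdsWithin.mono key)
  have : ‖v‖ = 0 := by nlinarith [norm_nonneg v]
  simpa using this

/-- If the norm were zero, `pairing_le` for `φ` and `-φ` would make `q` annihilate `C₀`. -/
theorem mNorm_pos {q : Meas T d} (hq : q ≠ 0) : 0 < mNorm q := by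
  refine (mNorm_nonneg q).lt_of_ne fun h0 => hq (eq_zero_of_pairing_eq_zero fun φ => ?_)
  have h1 := pairing_le φ q
  have h2 := pairing_le ((-1 : ℝ) • φ) q
  have h3 : pairing ((-1 : ℝ) • φ : C₀(Ioo (0 : ℝ) T, Vec d)) q = (-1) * pairing φ q :=
    pairing_smul q _ φ
  rw [← h0, mul_zero] at h1 h2
  linarith

theorem exists_bound_of_isTest {φ : ℝ → Vec d} (hφ : IsTest T φ) : ∃ c, ∀ t, ‖φ t‖ ≤ c :=
  hφ.contDiff.continuous.bounded_above_of_compact_support hφ.hasCompactSupport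

theorem integrable_isTest {φ : ℝ → Vec d} (hφ : IsTest T φ) (q : Meas T d) :
    q.Integrable fun t : Ioo (0 : ℝ) T => φ t :=
  let ⟨_, hc⟩ := exists_bound_of_isTest hφ
  integrable_variation q (hφ.contDiff.continuous.comp continuous_subtype_val) fun t => hc t

theorem isTest_deriv {φ : ℝ → Vec d} (hφ : IsTest T φ) : IsTest T (deriv φ) :=
  ⟨(contDiff_infty_iff_deriv.1 hφ.contDiff).2, hφ.hasCompactSupport.deriv,
    tsupport_deriv_subset.trans hφ.tsupport_subset⟩

/-- Test functions are dense in `C₀` for the sup norm. -/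
theorem exists_isTest_norm_sub_lt (φ : C₀(Ioo (0 : ℝ) T, Vec d)) {ε : ℝ} (hε : 0 < ε) :
    ∃ ψ : ℝ → Vec d, IsTest T ψ ∧ ∀ t : Ioo (0 : ℝ) T, ‖φ t - ψ t‖ < ε := by
  have hev : ∀ᶠ t in cocompact (Ioo (0 : ℝ) T), ‖φ t‖ < ε := by
    have := φ.zero_at_infty'
    exact (tendsto_zero_iff_norm_tendsto_zero.1 this).eventually (gt_mem_nhds hε)
  obtain ⟨K, hK, hKφ⟩ := mem_cocompact.1 hev
  have hK' : IsCompact ((↑) '' K : Set ℝ) := hK.image continuous_subtype_val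
  obtain ⟨L, hL, hKL, hLI⟩ := exists_compact_between hK' isOpen_Ioo
    (show ((↑) '' K : Set ℝ) ⊆ Ioo 0 T by rintro _ ⟨t, -, rfl⟩; exact t.2)
  -- Admissible values at `t`: within `ε` of `φ t`, and zero off `L`. These sets are convex, so a
  -- smooth partition of unity glues local constant choices: `φ x` near a point `x` of `K`, and `0`
  -- elsewhere, where `‖φ‖ < ε`.
  let P : ℝ → Set (Vec d) := fun t =>
    {x | (∀ h : t ∈ Ioo 0 T, ‖φ ⟨t, h⟩ - x‖ < ε) ∧ (t ∉ L → x = 0)}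
  have hconv : ∀ t, Convex ℝ (P t) := by
    intro t
    have : P t = (⋂ h : t ∈ Ioo 0 T, Metric.ball (φ ⟨t, h⟩) ε) ∩ (⋂ _ : t ∉ L, {0}) := by
      ext x
      simp [P, dist_eq_norm, norm_sub_rev x]
    rw [this]
    exact (convex_iInter fun h => convex_ball _ _).inter
      (convex_iInter fun _ => convex_singleton _)
  obtain ⟨g, hg⟩ := exists_contMDiffMap_forall_mem_convex_of_local_const (n := (⊤ : ℕ∞))
    (modelWithCornersSelf ℝ ℝ) hconv (by
      intro x
      by_cases hx : x ∈ ((↑) '' K : Set ℝ)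
      · have hxI : x ∈ Ioo 0 T := hLI (interior_subset (hKL hx))
        have hc : ContinuousAt φ ⟨x, hxI⟩ := φ.continuous.continuousAt
        have h1 : ∀ᶠ t in 𝓝 (⟨x, hxI⟩ : Ioo (0 : ℝ) T), ‖φ t - φ ⟨x, hxI⟩‖ < ε := by
          have := hc.eventually (Metric.ball_mem_nhds _ hε)
          simpa only [Metric.mem_ball, dist_eq_norm] using this
        rw [nhds_subtype_eq_comap, eventually_comap] at h1
        refine ⟨φ ⟨x, hxI⟩, ?_⟩
        filter_upwards [h1, isOpen_interior.mem_nhds (hKL hx)] with y hy hyL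
        exact ⟨fun h => hy ⟨y, h⟩ rfl, fun h => absurd (interior_subset hyL) h⟩
      · refine ⟨0, ?_⟩
        filter_upwards [hK'.isClosed.isOpen_compl.mem_nhds hx] with y hy
        refine ⟨fun h => ?_, fun _ => rfl⟩
        rw [sub_zero]
        exact hKφ fun hk => hy ⟨_, hk, rfl⟩)
  have hts : tsupport g ⊆ L :=
    closure_minimal (fun t ht => by_contra fun h => ht ((hg t).2 h)) hL.isClosed
  exact ⟨g, ⟨g.contMDiff.contDiff, hL.of_isClosed_subset (isClosed_tsupport _) hts,
    hts.trans hLI⟩, fun t => (hg t).1 t.2⟩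

/-- A vector measure that annihilates the test functions vanishes. -/
theorem eq_zero_of_pairing_isTest_eq_zero {q : Meas T d}
    (h : ∀ φ : ℝ → Vec d, IsTest T φ → pairing (fun t : Ioo (0 : ℝ) T => φ t) q = 0) :
    q = 0 := by
  refine eq_zero_of_pairing_eq_zero fun φ => ?_
  set V := ‖innerSL ℝ (E := Vec d)‖ * q.variation.real univ
  have key : ∀ ε > 0, |pairing φ q| ≤ ε * V := by
    intro ε hε
    obtain ⟨ψ, hψ, hd⟩ := exists_isTest_norm_sub_lt φ hε
    have := abs_pairing_le (fun t => (hd t).le) q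
    rwa [pairing_sub (integrable_C0 q φ) (integrable_isTest hψ q), h ψ hψ, sub_zero] at this
  have ht : Tendsto (fun ε : ℝ => ε * V) (𝓝[>] 0) (𝓝 0) := by
    have : Continuous fun ε : ℝ => ε * V := by fun_prop
    simpa using (this.tendsto 0).mono_left nhdsWithin_le_nhds
  have h0 := ge_of_tendsto ht (eventually_mem_nhdsWithin.mono key)
  exact abs_nonpos_iff.1 h0

/-! ### Uniqueness of the derivative and linear combinations in BV. -/

/-- Needed because `BV.deriv` is picked by choice: a derivative is identified by exhibiting any
measure with the defining property. -/
theorem IsDistribDeriv.eq {u : L1 T d} {q r : Meas T d} (hq : IsDistribDeriv u q)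
    (hr : IsDistribDeriv u r) : q = r := by
  refine sub_eq_zero.1 (eq_zero_of_pairing_isTest_eq_zero fun φ hφ => ?_)
  have : pairing (fun t : Ioo (0 : ℝ) T => φ t) (q - r) = _ :=
    VectorMeasure.integral_sub_vectorMeasure (integrable_isTest hφ q) (integrable_isTest hφ r)
  rw [this]
  exact sub_eq_zero.2 (neg_injective ((hq φ hφ).symm.trans (hr φ hφ)))

theorem BV.isDistribDeriv (u : BV T d) : IsDistribDeriv u.1 u.deriv := Classical.choose_spec u.2

theorem BV.deriv_eq {u : BV T d} {q : Meas T d} (h : IsDistribDeriv u.1 q) : u.deriv = q :=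
  u.isDistribDeriv.eq h

theorem integrable_inner_isTest {u : ℝ → Vec d} (hu : Integrable u (leb T)) {φ : ℝ → Vec d}
    (hφ : IsTest T φ) : Integrable (fun t => inner ℝ (u t) (φ t)) (leb T) := by
  obtain ⟨c, hc⟩ := exists_bound_of_isTest hφ
  refine (hu.norm.mul_const c).mono'
    (hu.aestronglyMeasurable.inner hφ.contDiff.continuous.aestronglyMeasurable)
    (ae_of_all _ fun t => (norm_inner_le_norm _ _).trans ?_)
  gcongr
  exact hc t

theorem IsDistribDeriv.add_smul {u v : L1 T d} {q r : Meas T d} (hu : IsDistribDeriv u q)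
    (hv : IsDistribDeriv v r) (c : ℝ) : IsDistribDeriv (u + c • v) (q + c • r) := by
  intro φ hφ
  have hφ' := isTest_deriv hφ
  rw [pairing_add_smul _ (integrable_isTest hφ q) (integrable_isTest hφ r), neg_add,
    ← mul_neg, ← hu φ hφ, ← hv φ hφ, ← integral_const_mul,
    ← integral_add (integrable_inner_isTest (L1.integrable_coeFn u) hφ')
      ((integrable_inner_isTest (L1.integrable_coeFn v) hφ').const_mul c)]
  refine integral_congr_ae ?_
  filter_upwards [Lp.coeFn_add u (c • v), Lp.coeFn_smul c v] with t h1 h2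
  rw [h1, Pi.add_apply, h2, Pi.smul_apply, inner_add_left, real_inner_smul_left]

/-- The function `u + c v` of bounded variation. -/
noncomputable def BV.addSmul (u : BV T d) (c : ℝ) (v : BV T d) : BV T d :=
  ⟨u.1 + c • v.1, _, u.isDistribDeriv.add_smul v.isDistribDeriv c⟩

theorem BV.deriv_addSmul (u : BV T d) (c : ℝ) (v : BV T d) :
    (u.addSmul c v).deriv = u.deriv + c • v.deriv :=
  BV.deriv_eq (u.isDistribDeriv.add_smul v.isDistribDeriv c)

theorem BV.coeFn_toL2 (u : BV T d) : u.toL2 =ᵐ[leb T] u.1 := u.memLp_two.coeFn_toLp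

theorem BV.toL2_addSmul (u : BV T d) (c : ℝ) (v : BV T d) :
    (u.addSmul c v).toL2 = u.toL2 + c • v.toL2 := by
  refine Lp.ext ?_
  filter_upwards [(u.addSmul c v).coeFn_toL2, u.coeFn_toL2, v.coeFn_toL2,
    Lp.coeFn_add u.toL2 (c • v.toL2), Lp.coeFn_smul c v.toL2, Lp.coeFn_add u.1 (c • v.1),
    Lp.coeFn_smul c v.1] with t h1 h2 h3 h4 h5 h6 h7
  rw [h1, h4, Pi.add_apply, h5, Pi.smul_apply, h2, h3]
  show (u.1 + c • v.1) t = _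
  rw [h6, Pi.add_apply, h7, Pi.smul_apply]

/-! ### Step functions as test directions. -/

/-- The step function equal to `e` on `(s, T)` and to `0` on `(0, s]`. -/
theorem exists_step (s : Ico (0 : ℝ) T) (e : Vec d) (q : Meas T d)
    (hq : ∀ φ : ℝ → Vec d, IsTest T φ →
      pairing (fun t : Ioo (0 : ℝ) T => φ t) q = inner ℝ (φ s) e) :
    ∃ v : BV T d, v.1 =ᵐ[leb T] (Ioo s.1 T).indicator (fun _ => e) ∧ v.deriv = q := by
  have hmem : MemLp ((Ioo s.1 T).indicator (fun _ => e)) 1 (leb T) :=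
    memLp_indicator_const 1 measurableSet_Ioo e (Or.inr (measure_ne_top _ _))
  have hae : (hmem.toLp _ : ℝ → Vec d) =ᵐ[leb T] (Ioo s.1 T).indicator (fun _ => e) :=
    hmem.coeFn_toLp
  have hD : IsDistribDeriv (hmem.toLp _) q := by
    intro φ hφ
    rw [hq φ hφ]
    have hd : ∀ t, HasDerivAt φ (deriv φ t) t := fun t =>
      (hφ.contDiff.differentiable (by simp) t).hasDerivAt
    have hc : Continuous (deriv φ) := (isTest_deriv hφ).contDiff.continuous
    -- The boundary term at `T` vanishes, so integrating `(e, φ')` over `(s, T)` leaves `-(φ s, e)`.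
    -- For `s = 0` this vanishes too and `v` is constant; for `s > 0` it is a Dirac mass.
    have hT : φ T = 0 := image_eq_zero_of_notMem_tsupport fun h =>
      lt_irrefl _ (hφ.tsupport_subset h).2
    have h1 : ∫ t in Ioo 0 T, inner ℝ ((hmem.toLp _ : ℝ → Vec d) t) (deriv φ t) =
        ∫ t in Ioo 0 T, (Ioo s.1 T).indicator (fun t => inner ℝ e (deriv φ t)) t := by
      refine integral_congr_ae ?_
      filter_upwards [hae] with t ht
      rw [ht]
      by_cases h : t ∈ Ioo s.1 T <;> simp [h]
    rw [h1, setIntegral_indicator measurableSet_Ioo,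
      inter_eq_self_of_subset_right (Ioo_subset_Ioo_left s.2.1),
      ← integral_Ioc_eq_integral_Ioo, ← intervalIntegral.integral_of_le s.2.2.le,
      intervalIntegral.integral_eq_sub_of_hasDerivAt (f := fun t => inner ℝ e (φ t))
        (fun t _ => by simpa using (hasDerivAt_const t e).inner ℝ (hd t))
        ((continuous_const.inner hc).intervalIntegrable _ _), hT, inner_zero_right, zero_sub,
      real_inner_comm]
  exact ⟨⟨hmem.toLp _, q, hD⟩, hae, BV.deriv_eq hD⟩

/-! ### Primitives of `L²` functions. -/

theorem integrable_L2 (x : L2 T d) : Integrable x (leb T) :=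
  (Lp.memLp x).integrable (by norm_num)

theorem intervalIntegrable_L2 (hT : 0 < T) (x : L2 T d) : IntervalIntegrable x volume 0 T :=
  (intervalIntegrable_iff_integrableOn_Ioo_of_le hT.le).2 (integrable_L2 x)

theorem intervalIntegrable_L2_of_mem (hT : 0 < T) (x : L2 T d) {t : ℝ} (ht : t ∈ Icc 0 T) :
    IntervalIntegrable x volume 0 t :=
  (intervalIntegrable_L2 hT x).mono_set
    (uIcc_subset_uIcc_left (by rwa [uIcc_of_le hT.le]))

theorem primitive_congr {f g : ℝ → Vec d} (h : f =ᵐ[leb T] g) {t : ℝ} (ht : t ∈ Ioo 0 T) :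
    ∫ s in (0 : ℝ)..t, f s = ∫ s in (0 : ℝ)..t, g s := by
  refine intervalIntegral.integral_congr_ae_restrict ?_
  rw [uIoc_of_le ht.1.le]
  exact ae_restrict_of_ae_restrict_of_subset
    (show Ioc 0 t ⊆ Ioo 0 T from fun s hs => ⟨hs.1, hs.2.trans_lt ht.2⟩) h

theorem continuousOn_primitive (hT : 0 < T) (x : L2 T d) :
    ContinuousOn (fun t => ∫ s in (0 : ℝ)..t, x s) (Icc 0 T) := by
  have := intervalIntegral.continuousOn_primitive_interval' (intervalIntegrable_L2 hT x)
    (left_mem_uIcc)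
  rwa [uIcc_of_le hT.le] at this

theorem norm_primitive_le (x : L2 T d) {t : ℝ} (ht : t ∈ Ioo 0 T) :
    ‖∫ s in (0 : ℝ)..t, x s‖ ≤ ∫ s in Ioo 0 T, ‖x s‖ := by
  rw [intervalIntegral.integral_of_le ht.1.le]
  refine (norm_integral_le_integral_norm _).trans ?_
  exact setIntegral_mono_set (integrable_L2 x).norm (ae_of_all _ fun s => norm_nonneg _)
    (show Ioc 0 t ⊆ Ioo 0 T from fun s hs => ⟨hs.1, hs.2.trans_lt ht.2⟩).eventuallyLE

theorem integrable_primitive (hT : 0 < T) (x : L2 T d) (q : Meas T d) :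
    q.Integrable fun t : Ioo (0 : ℝ) T => ∫ s in (0 : ℝ)..t, x s :=
  integrable_variation q
    ((continuousOn_iff_continuous_domRestrict.1 ((continuousOn_primitive hT x).mono
      Ioo_subset_Icc_self))) fun t => norm_primitive_le x t.2

theorem exists_integral_norm_le (T : ℝ) (d : ℕ) :
    ∃ c : ℝ, ∀ x : L2 T d, ∫ t in Ioo 0 T, ‖x t‖ ≤ c * ‖x‖ := by
  -- The Hölder constant of `L² ⊂ L¹`: the measure of the interval to the power `1 - 1/2`.
  refine ⟨(volume (Ioo 0 T) ^ ((1 : ℝ) / (1 : ℝ≥0∞).toReal - 1 / (2 : ℝ≥0∞).toReal)).toReal,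
    fun x => ?_⟩
  have h1 := eLpNorm_le_eLpNorm_mul_rpow_measure_univ (p := 1) (q := 2) (μ := leb T)
    (by norm_num) (Lp.aestronglyMeasurable x)
  rw [Measure.restrict_apply_univ] at h1
  have h2 := ENNReal.toReal_mono (ENNReal.mul_ne_top (Lp.eLpNorm_ne_top x)
    (ENNReal.rpow_ne_top_of_nonneg (by norm_num) (by simp))) h1
  rw [ENNReal.toReal_mul, ← Lp.norm_def, mul_comm] at h2
  refine le_trans (le_of_eq ?_) h2
  rw [eLpNorm_one_eq_lintegral_enorm]
  exact integral_norm_eq_lintegral_enorm (Lp.aestronglyMeasurable x)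

/-- The functional `x ↦ ⟨∫_0^· x, q⟩` on `L²`. -/
theorem exists_pairing_primitive (hT : 0 < T) (q : Meas T d) :
    ∃ ℓ : L2 T d →L[ℝ] ℝ, ∀ x : L2 T d,
      ℓ x = pairing (fun t : Ioo (0 : ℝ) T => ∫ s in (0 : ℝ)..t, x s) q := by
  obtain ⟨c, hc⟩ := exists_integral_norm_le T d
  let ℓ₀ : L2 T d →ₗ[ℝ] ℝ :=
    { toFun := fun x => pairing (fun t : Ioo (0 : ℝ) T => ∫ s in (0 : ℝ)..t, x s) q
      map_add' := by
        intro x y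
        unfold pairing
        rw [← VectorMeasure.integral_fun_add (integrable_primitive hT x q)
          (integrable_primitive hT y q)]
        congr 1
        funext t
        have ht := Ioo_subset_Icc_self t.2
        rw [← intervalIntegral.integral_add (intervalIntegrable_L2_of_mem hT x ht)
          (intervalIntegrable_L2_of_mem hT y ht)]
        exact primitive_congr (Lp.coeFn_add x y) t.2
      map_smul' := by
        intro a x
        rw [RingHom.id_apply, smul_eq_mul, ← pairing_smul]
        congr 1
        funext t
        rw [← intervalIntegral.integral_smul]
        exact primitive_congr (Lp.coeFn_smul a x) t.2 }
  refine ⟨ℓ₀.mkContinuous (c * (‖innerSL ℝ (E := Vec d)‖ * q.variation.real univ)) fun x => ?_,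
    fun x => rfl⟩
  have := abs_pairing_le (fun t : Ioo (0 : ℝ) T => (norm_primitive_le x t.2).trans (hc x)) q
  rw [mul_right_comm]
  exact this

/-! ### The du Bois-Reymond lemma and integration by parts. -/

/-- A function whose distributional derivative vanishes is constant. -/
theorem exists_ae_eq_const (hT : 0 < T) {h : ℝ → Vec d} (hh : Integrable h (leb T))
    (h0 : ∀ φ : ℝ → Vec d, IsTest T φ → ∫ t in Ioo 0 T, inner ℝ (h t) (deriv φ t) = 0) :
    ∃ a : Vec d, h =ᵐ[leb T] fun _ => a := by
  let ρb : ContDiffBump (T / 2) := ⟨T / 8, T / 4, by linarith, by linarith⟩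
  let ρ : ℝ → ℝ := ρb.normed volume
  have hρsup : tsupport ρ ⊆ Ioo 0 T := by
    rw [ρb.tsupport_normed_eq, Real.closedBall_eq_Icc]
    intro t ht
    have h1 : T / 2 - T / 4 ≤ t := ht.1
    have h2 : t ≤ T / 2 + T / 4 := ht.2
    exact ⟨by linarith, by linarith⟩
  have hρd : ContDiff ℝ ∞ ρ := ρb.contDiff_normed
  have hρ1 : ∫ t in Ioo 0 T, ρ t = 1 := by
    rw [setIntegral_eq_integral_of_forall_compl_eq_zero, ρb.integral_normed]
    exact fun t ht => image_eq_zero_of_notMem_tsupport fun h => ht (hρsup h)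
  have hρint : IntegrableOn ρ (Ioo 0 T) :=
    (hρd.continuous.integrableOn_Icc (a := 0) (b := T)).mono_set Ioo_subset_Icc_self
  have hint : ∀ f : ℝ → Vec d, IsTest T f → Integrable f (leb T) := fun f hf =>
    (hf.contDiff.continuous.integrableOn_Icc (a := 0) (b := T)).mono_set Ioo_subset_Icc_self
  obtain ⟨cρ, hcρ⟩ :=
    hρd.continuous.bounded_above_of_compact_support ρb.hasCompactSupport_normed
  have hsm : ∀ (η : ℝ → ℝ) (m : Vec d), ContDiff ℝ ∞ η → HasCompactSupport η →
      tsupport η ⊆ Ioo 0 T → IsTest T fun t => η t • m := fun η m hη hηc hηs =>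
    have hs : tsupport (fun t => η t • m) ⊆ tsupport η :=
      closure_mono (Function.support_smul_subset_left η fun _ => m)
    ⟨hη.smul contDiff_const, hηc.isCompact.of_isClosed_subset (isClosed_tsupport _) hs,
      hs.trans hηs⟩
  have hρh : Integrable (fun t => ρ t • h t) (leb T) :=
    hh.bdd_smul cρ hρd.continuous.aestronglyMeasurable (ae_of_all _ hcρ)
  -- As `ρ` has integral one, a constant `h` must equal this weighted mean.
  let a : Vec d := ∫ t in Ioo 0 T, ρ t • h t
  have key : ∀ ψ : ℝ → Vec d, IsTest T ψ →
      ∫ t in Ioo 0 T, inner ℝ (h t) (ψ t) = inner ℝ a (∫ t in Ioo 0 T, ψ t) := by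
    intro ψ hψ
    set m := ∫ t in Ioo 0 T, ψ t
    have hρm := hsm ρ m hρd ρb.hasCompactSupport_normed hρsup
    -- Subtracting `ρ m` removes the mean of `ψ`, so the difference is the derivative of a test
    -- function and `h0` applies.
    have hw : IsTest T fun t => ψ t - ρ t • m :=
      ⟨hψ.contDiff.sub hρm.contDiff, hψ.hasCompactSupport.sub hρm.hasCompactSupport,
        (tsupport_sub _ _).trans (union_subset hψ.tsupport_subset hρm.tsupport_subset)⟩
    have hw0 : ∫ t in Ioo 0 T, (ψ t - ρ t • m) = 0 := by
      rw [integral_sub (hint ψ hψ) (hρint.smul_const m), integral_smul_const, hρ1, one_smul,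
        sub_self]
    obtain ⟨φ, hφ, hφw, -⟩ := exists_test_primitive hT hw hw0
    have h1 := h0 φ hφ
    simp only [hφw, inner_sub_right] at h1
    rw [integral_sub (integrable_inner_isTest hh hψ) (integrable_inner_isTest hh hρm),
      sub_eq_zero] at h1
    rw [h1, real_inner_comm m a, ← integral_inner hρh m]
    refine integral_congr_ae (ae_of_all _ fun t => ?_)
    simp only [real_inner_smul_right, real_inner_smul_left, real_inner_comm]
  refine ⟨a, ?_⟩
  have hae : ∀ᵐ t ∂(leb T), t ∈ Ioo 0 T → (h t - a) = 0 := by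
    refine isOpen_Ioo.ae_eq_zero_of_integral_contDiff_smul_eq_zero (f := fun t => h t - a)
      ((hh.sub (integrable_const a)).locallyIntegrable.locallyIntegrableOn _) ?_
    intro g hg hgc hgs
    obtain ⟨c, hc⟩ := hg.continuous.bounded_above_of_compact_support hgc
    have hgh : Integrable (fun t => g t • h t) (leb T) :=
      hh.bdd_smul c hg.continuous.aestronglyMeasurable (ae_of_all _ hc)
    have hgi : IntegrableOn g (Ioo 0 T) :=
      (hg.continuous.integrableOn_Icc (a := 0) (b := T)).mono_set Ioo_subset_Icc_self
    refine ext_inner_left ℝ fun v => ?_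
    have k := key _ (hsm g v hg hgc hgs)
    simp_rw [smul_sub]
    rw [integral_sub hgh (hgi.smul_const a), inner_sub_right, ← integral_inner hgh v,
      integral_smul_const, inner_zero_right, sub_eq_zero, real_inner_smul_right]
    rw [integral_smul_const, real_inner_smul_right, real_inner_comm] at k
    rw [← k]
    refine integral_congr_ae (ae_of_all _ fun t => ?_)
    simp only [real_inner_smul_right, real_inner_comm]
  filter_upwards [hae, ae_restrict_mem measurableSet_Ioo] with t h1 h2
  exact sub_eq_zero.1 (h1 h2)

/-- Integration by parts against the primitive of an `L²` function of mean zero. -/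
theorem inner_toL2_eq_neg_pairing (hT : 0 < T) (v : BV T d) (g : L2 T d)
    (hg : ∫ t in Ioo 0 T, g t = 0) :
    inner ℝ v.toL2 g =
      -pairing (fun t : Ioo (0 : ℝ) T => ∫ s in (0 : ℝ)..t, g s) v.deriv := by
  obtain ⟨ℓ, hℓ⟩ := exists_pairing_primitive hT v.deriv
  let D : Set (L2 T d) := {x | ∃ φ, IsTest T φ ∧ x =ᵐ[leb T] deriv φ}
  have hmem : ∀ φ : ℝ → Vec d, IsTest T φ → MemLp φ 2 (leb T) := fun φ hφ =>
    let ⟨c, hc⟩ := exists_bound_of_isTest hφ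
    MemLp.of_bound hφ.contDiff.continuous.aestronglyMeasurable c (ae_of_all _ hc)
  -- Density via the double orthogonal complement: anything orthogonal to `D` is constant, and `g`
  -- has mean zero.
  have hgD : g ∈ (Submodule.span ℝ D).topologicalClosure := by
    rw [← Submodule.orthogonal_orthogonal_eq_closure]
    refine (Submodule.mem_orthogonal _ _).2 fun h hh => ?_
    have h0 : ∀ φ : ℝ → Vec d, IsTest T φ →
        ∫ t in Ioo 0 T, inner ℝ (h t) (deriv φ t) = 0 := by
      intro φ hφ
      have hφ' := hmem _ (isTest_deriv hφ)
      have h1 := (Submodule.mem_orthogonal' _ _).1 hh (hφ'.toLp _)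
        (Submodule.subset_span ⟨φ, hφ, hφ'.coeFn_toLp⟩)
      rw [L2.inner_def] at h1
      refine (integral_congr_ae ?_).trans h1
      filter_upwards [hφ'.coeFn_toLp] with t ht
      rw [ht]
    obtain ⟨a, ha⟩ := exists_ae_eq_const hT (integrable_L2 h) h0
    have h1 : ∫ t in Ioo 0 T, inner ℝ a (g t) = 0 := by
      rw [integral_inner (integrable_L2 g) a, hg, inner_zero_right]
    rw [L2.inner_def]
    refine (integral_congr_ae ?_).trans h1
    filter_upwards [ha] with t ht
    rw [ht]
  -- The claim says that the continuous functional `(v, ·) + ℓ` kills `g`. On `D` this is the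
  -- definition of the distributional derivative, and the kernel is closed.
  have hle : Submodule.span ℝ D ≤ LinearMap.ker (innerSL ℝ v.toL2 + ℓ).toLinearMap := by
    refine Submodule.span_le.2 ?_
    rintro x ⟨φ, hφ, hx⟩
    show inner ℝ v.toL2 x + ℓ x = 0
    have e1 : inner ℝ v.toL2 x = ∫ t in Ioo 0 T, inner ℝ (v.1 t) (deriv φ t) := by
      rw [L2.inner_def]
      refine integral_congr_ae ?_
      filter_upwards [hx, v.coeFn_toL2] with t h1 h2
      rw [h1, h2]
    have e2 : ∀ t : Ioo (0 : ℝ) T, ∫ s in (0 : ℝ)..t, x s = φ t := by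
      intro t
      have h0 : φ 0 = 0 := image_eq_zero_of_notMem_tsupport fun h =>
        lt_irrefl _ (hφ.tsupport_subset h).1
      rw [← sub_zero (φ t), ← h0, ← intervalIntegral.integral_deriv_eq_sub
        (fun s _ => hφ.contDiff.differentiable (by simp) s)
        ((isTest_deriv hφ).contDiff.continuous.intervalIntegrable _ _)]
      exact primitive_congr hx t.2
    rw [hℓ, e1, v.isDistribDeriv φ hφ]
    simp only [e2]
    exact neg_add_cancel _
  have h := Submodule.topologicalClosure_minimal _ hle
    (ContinuousLinearMap.isClosed_ker (innerSL ℝ v.toL2 + ℓ)) hgD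
  have h' : inner ℝ v.toL2 g + ℓ g = 0 := h
  rw [← hℓ]
  exact eq_neg_of_add_eq_zero_left h'

/-- The primitive vanishes at both endpoints, so each set where its norm is at least `ε > 0` is
compact in `[0, T]` and avoids `0` and `T`; it is therefore compact in the open interval. -/
theorem exists_C0_primitive (hT : 0 < T) (g : L2 T d) (hg : ∫ s in (0 : ℝ)..T, g s = 0) :
    ∃ φ : C₀(Ioo (0 : ℝ) T, Vec d), ∀ t, φ t = ∫ s in (0 : ℝ)..t, g s := by
  have hc := continuousOn_primitive hT g
  refine ⟨⟨⟨fun t => ∫ s in (0 : ℝ)..t, g s,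
    continuousOn_iff_continuous_domRestrict.1 (hc.mono Ioo_subset_Icc_self)⟩, ?_⟩, fun t => rfl⟩
  refine tendsto_zero_iff_norm_tendsto_zero.2 (tendsto_order.2 ⟨fun a ha =>
    Eventually.of_forall fun t => ha.trans_le (norm_nonneg _), fun ε hε => ?_⟩)
  have hK : IsCompact (Icc 0 T ∩ (fun t => ‖∫ s in (0 : ℝ)..t, g s‖) ⁻¹' Ici ε) :=
    isCompact_Icc.of_isClosed_subset
      (hc.norm.preimage_isClosed_of_isClosed isClosed_Icc isClosed_Ici) inter_subset_left
  have hsub : Icc 0 T ∩ (fun t => ‖∫ s in (0 : ℝ)..t, g s‖) ⁻¹' Ici ε ⊆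
      range ((↑) : Ioo (0 : ℝ) T → ℝ) := by
    rw [Subtype.range_coe]
    rintro t ⟨ht, hε'⟩
    have hε' : ε ≤ ‖∫ s in (0 : ℝ)..t, g s‖ := hε'
    refine ⟨ht.1.lt_of_ne ?_, ht.2.lt_of_ne ?_⟩
    · rintro rfl
      rw [intervalIntegral.integral_same, norm_zero] at hε'
      linarith
    · rintro rfl
      rw [hg, norm_zero] at hε'
      linarith
  refine mem_cocompact.2 ⟨_, Topology.IsInducing.subtypeVal.isCompact_preimage' hK hsub, ?_⟩
  intro t ht
  by_contra hn
  exact ht ⟨Ioo_subset_Icc_self t.2, show ε ≤ _ from not_lt.1 hn⟩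

theorem cNorm_eq (hT : 0 < T) {p : ℝ → Vec d} {φ : C₀(Ioo (0 : ℝ) T, Vec d)}
    (h : ∀ t, φ t = p t) : cNorm T p = ‖φ‖ := by
  have : Nonempty (Ioo (0 : ℝ) T) := ⟨⟨T / 2, by constructor <;> linarith⟩⟩
  have hle : ∀ t : Ioo (0 : ℝ) T, ‖p t‖ ≤ ‖φ‖ := fun t => h t ▸ norm_C0_apply_le φ t
  refine le_antisymm (ciSup_le hle) (norm_C0_le ?_ fun t => ?_)
  · exact Real.iSup_nonneg fun t => norm_nonneg _
  · rw [h]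
    exact le_ciSup (f := fun t : Ioo (0 : ℝ) T => ‖p t‖) ⟨‖φ‖, by rintro _ ⟨t, rfl⟩; exact hle t⟩ t

/-! ### First-order conditions: necessity, then sufficiency. -/

section Problem

variable {Y : Type*} [NormedAddCommGroup Y] [InnerProductSpace ℝ Y] [CompleteSpace Y]

theorem hasDerivAt_add_smul {F : Y → ℝ} {y : Y} (hF : DifferentiableAt ℝ F y) (z : Y) :
    HasDerivAt (fun ε : ℝ => F (y + ε • z)) (inner ℝ (gradient F y) z) 0 := by
  have h1 : HasDerivAt (fun ε : ℝ => y + ε • z) z 0 := by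
    simpa using ((hasDerivAt_id (0 : ℝ)).smul_const z).const_add y
  have h2 : HasFDerivAt F (InnerProductSpace.toDual ℝ Y (gradient F y)) (y + (0 : ℝ) • z) := by
    rw [zero_smul, add_zero]
    exact hF.hasGradientAt.hasFDerivAt
  have := h2.comp_hasDerivAt (0 : ℝ) h1
  rwa [InnerProductSpace.toDual_apply_apply] at this

theorem add_inner_gradient_le {F : Y → ℝ} (hconv : ConvexOn ℝ univ F) {y : Y}
    (hF : DifferentiableAt ℝ F y) (z : Y) : F y + inner ℝ (gradient F y) z ≤ F (y + z) := by
  have hc : ConvexOn ℝ univ fun ε : ℝ => F (y + ε • z) := by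
    have := hconv.comp_affineMap (AffineMap.lineMap y (y + z) : ℝ →ᵃ[ℝ] Y)
    refine this.congr fun ε _ => ?_
    simp [AffineMap.lineMap_apply, add_comm]
  have h := hc.le_slope_of_hasDerivAt (mem_univ 0) (mem_univ 1) zero_lt_one
    (hasDerivAt_add_smul hF z)
  simp only [slope, sub_zero, inv_one, vsub_eq_sub, one_smul, zero_smul, add_zero] at h
  linarith

theorem inner_gradient_apply (K : L2 T d →L[ℝ] Y) (F : Y → ℝ) (y : Y) (x : L2 T d) :
    inner ℝ (gradient F y) (K x) = inner ℝ x (ContinuousLinearMap.adjoint K (gradient F y)) := by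
  rw [← ContinuousLinearMap.adjoint_inner_left, real_inner_comm]

/-- First-order optimality condition in the direction `v`. -/
theorem inner_add_nonneg_of_isMinOn {K : L2 T d →L[ℝ] Y} {F : Y → ℝ} {β : ℝ} (hβ : 0 ≤ β)
    (hF : Differentiable ℝ F) {u : BV T d} (hu : IsMinOn (objective K F β) univ u) (v : BV T d)
    {c : ℝ} (hc : ∀ ε : ℝ, 0 < ε → ε ≤ 1 →
      mNorm (u.deriv + ε • v.deriv) ≤ mNorm u.deriv + ε * c) :
    0 ≤ inner ℝ v.toL2 (ContinuousLinearMap.adjoint K (gradient F (K u.toL2))) + β * c := by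
  -- The norm term need not be differentiable, so its increment is replaced by the linear majorant
  -- `ε * (β * c)`. The resulting differentiable function still has nonnegative right difference
  -- quotients at `0`.
  have hd : HasDerivAt (fun ε : ℝ => F (K u.toL2 + ε • K v.toL2) + ε * (β * c))
      (inner ℝ (gradient F (K u.toL2)) (K v.toL2) + 1 * (β * c)) 0 :=
    (hasDerivAt_add_smul (hF _) _).add ((hasDerivAt_id (0 : ℝ)).mul_const _)
  rw [inner_gradient_apply, one_mul] at hd
  refine ge_of_tendsto hd.tendsto_slope_zero_right ?_
  filter_upwards [Ioc_mem_nhdsGT (zero_lt_one (α := ℝ))] with ε hε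
  have h1 : objective K F β u ≤ objective K F β (u.addSmul ε v) := hu (mem_univ _)
  unfold objective at h1
  rw [BV.toL2_addSmul, BV.deriv_addSmul, map_add, map_smul] at h1
  have h2 := mul_le_mul_of_nonneg_left (hc ε hε.1 hε.2) hβ
  simp only [zero_add, zero_smul, add_zero, zero_mul, smul_eq_mul]
  refine mul_nonneg (inv_nonneg.2 hε.1.le) ?_
  linarith

/-- Adding constants leaves the derivative unchanged; the constant direction `-p(T)` turns the
variational inequality into `-‖p(T)‖ ^ 2 ≥ 0`. -/
theorem dualVar_apply_T_eq_zero {K : L2 T d →L[ℝ] Y} {F : Y → ℝ} {β : ℝ} (hT : 0 < T)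
    (hβ : 0 ≤ β) (hF : Differentiable ℝ F) {u : BV T d}
    (hu : IsMinOn (objective K F β) univ u) : dualVar K F u T = 0 := by
  set g := ContinuousLinearMap.adjoint K (gradient F (K u.toL2)) with hg
  have hp : dualVar K F u T = ∫ t in Ioo 0 T, g t := by
    unfold dualVar
    rw [intervalIntegral.integral_of_le hT.le, integral_Ioc_eq_integral_Ioo]
  set e := -dualVar K F u T with he
  obtain ⟨v, hv, hv'⟩ := exists_step ⟨0, le_rfl, hT⟩ e 0 fun φ hφ => by
    have h0 : φ 0 = 0 := image_eq_zero_of_notMem_tsupport fun h =>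
      lt_irrefl _ (hφ.tsupport_subset h).1
    show _ = inner ℝ (φ 0) e
    rw [h0, inner_zero_left]
    exact VectorMeasure.integral_zero_vectorMeasure
  have h := inner_add_nonneg_of_isMinOn hβ hF hu v (c := 0) fun ε hε _ => by
    rw [hv']
    exact (mNorm_add_smul_le _ _ hε.le).trans_eq (by rw [mNorm_zero])
  have h1 : inner ℝ v.toL2 g = inner ℝ e (∫ t in Ioo 0 T, g t) := by
    rw [L2.inner_def, ← integral_inner (integrable_L2 g) e]
    refine integral_congr_ae ?_
    filter_upwards [v.coeFn_toL2, hv, ae_restrict_mem measurableSet_Ioo] with t h1 h2 h3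
    rw [h1, h2, indicator_of_mem h3]
  rw [← hg, h1, ← hp, he, inner_neg_left, real_inner_self_eq_norm_sq, mul_zero, add_zero] at h
  have : ‖dualVar K F u T‖ = 0 := by nlinarith [norm_nonneg (dualVar K F u T)]
  exact norm_eq_zero.1 this

/-- A step with jump `e = p(s)` at `s` costs at most `β ‖e‖` and, after integration by parts, gives
`0 ≤ -‖e‖ ^ 2 + β ‖e‖`. -/
theorem norm_dualVar_le {K : L2 T d →L[ℝ] Y} {F : Y → ℝ} {β : ℝ} (hT : 0 < T)
    (hβ : 0 ≤ β) (hF : Differentiable ℝ F) {u : BV T d}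
    (hu : IsMinOn (objective K F β) univ u) (s : Ioo (0 : ℝ) T) : ‖dualVar K F u s‖ ≤ β := by
  set g := ContinuousLinearMap.adjoint K (gradient F (K u.toL2)) with hg
  set e := dualVar K F u s with he
  obtain ⟨v, -, hv'⟩ := exists_step ⟨s.1, s.2.1.le, s.2.2⟩ e (VectorMeasure.dirac s e)
    fun φ hφ => pairing_dirac _ s e
  have h := inner_add_nonneg_of_isMinOn hβ hF hu v (c := ‖e‖) fun ε hε _ => by
    rw [hv']
    exact (mNorm_add_smul_le _ _ hε.le).trans
      (by gcongr; exact mNorm_dirac_le s e)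
  have hgT : ∫ t in Ioo 0 T, g t = 0 := by
    rw [← integral_Ioc_eq_integral_Ioo, ← intervalIntegral.integral_of_le hT.le]
    exact dualVar_apply_T_eq_zero hT hβ hF hu
  rw [← hg, inner_toL2_eq_neg_pairing hT v g hgT, hv', pairing_dirac] at h
  have h2 : inner ℝ (∫ r in (0 : ℝ)..s, g r) e = ‖e‖ ^ 2 := real_inner_self_eq_norm_sq e
  rw [h2] at h
  by_contra hlt
  nlinarith [norm_nonneg e]

theorem pairing_dualVar_eq {K : L2 T d →L[ℝ] Y} {F : Y → ℝ} {β : ℝ} (hT : 0 < T)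
    (hβ : 0 ≤ β) (hF : Differentiable ℝ F) {u : BV T d}
    (hu : IsMinOn (objective K F β) univ u) :
    pairing (fun t : Ioo (0 : ℝ) T => dualVar K F u t) u.deriv = β * mNorm u.deriv := by
  set g := ContinuousLinearMap.adjoint K (gradient F (K u.toL2)) with hg
  have hgT : ∫ t in Ioo 0 T, g t = 0 := by
    rw [← integral_Ioc_eq_integral_Ioo, ← intervalIntegral.integral_of_le hT.le]
    exact dualVar_apply_T_eq_zero hT hβ hF hu
  have h1 := inner_add_nonneg_of_isMinOn hβ hF hu u (c := mNorm u.deriv)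
    fun ε hε _ => mNorm_add_smul_le _ _ hε.le
  -- The direction `u - 2 u = -u` yields the inequality opposite to `h1`.
  have h2 := inner_add_nonneg_of_isMinOn hβ hF hu (u.addSmul (-2) u) (c := -mNorm u.deriv)
    fun ε _ hε => by
      rw [BV.deriv_addSmul]
      exact mNorm_add_smul_reflection_le _ hε
  rw [BV.toL2_addSmul, inner_add_left, real_inner_smul_left] at h2
  have h3 := inner_toL2_eq_neg_pairing hT u g hgT
  rw [← hg] at h1 h2
  show pairing (fun t : Ioo (0 : ℝ) T => ∫ s in (0 : ℝ)..t, g s) u.deriv = _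
  linarith

theorem isMinOn_of_dualVar {K : L2 T d →L[ℝ] Y} {F : Y → ℝ} {β : ℝ} (hT : 0 < T)
    (hconv : ConvexOn ℝ univ F) (hF : Differentiable ℝ F) {u : BV T d}
    (hβ : cNorm T (dualVar K F u) ≤ β) (hpT : dualVar K F u T = 0)
    (hpu : pairing (fun t : Ioo (0 : ℝ) T => dualVar K F u t) u.deriv = β * mNorm u.deriv) :
    IsMinOn (objective K F β) univ u := by
  intro v _
  set g := ContinuousLinearMap.adjoint K (gradient F (K u.toL2)) with hg
  have hgT : ∫ t in Ioo 0 T, g t = 0 := by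
    rw [← integral_Ioc_eq_integral_Ioo, ← intervalIntegral.integral_of_le hT.le]
    exact hpT
  obtain ⟨φ, hφ⟩ := exists_C0_primitive hT g hpT
  have hφβ : ‖φ‖ ≤ β := (cNorm_eq hT (p := dualVar K F u) hφ).symm.le.trans hβ
  have h1 := add_inner_gradient_le hconv (hF (K u.toL2)) (K v.toL2 - K u.toL2)
  rw [inner_sub_right, inner_gradient_apply, inner_gradient_apply, ← hg,
    inner_toL2_eq_neg_pairing hT v g hgT, inner_toL2_eq_neg_pairing hT u g hgT,
    add_sub_cancel] at h1
  have h2 : pairing (fun t : Ioo (0 : ℝ) T => ∫ s in (0 : ℝ)..t, g s) v.deriv ≤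
      β * mNorm v.deriv := by
    rw [← funext hφ]
    exact (pairing_le φ _).trans (mul_le_mul_of_nonneg_right hφβ (mNorm_nonneg _))
  have h3 : pairing (fun t : Ioo (0 : ℝ) T => ∫ s in (0 : ℝ)..t, g s) u.deriv =
      β * mNorm u.deriv := hpu
  show objective K F β u ≤ objective K F β v
  unfold objective
  linarith

end Problem

end BVOpt

theorem mainTheorem4 {Y : Type*} [NormedAddCommGroup Y] [InnerProductSpace ℝ Y] [CompleteSpace Y]
    (T : ℝ) (hT : 0 < T) (d : ℕ) (β : ℝ) (hβ : 0 < β)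
    (K : BVOpt.L2 T d →L[ℝ] Y) (F : Y → ℝ)
    (hFconv : StrictConvexOn ℝ univ F) (hFdiff : ContDiff ℝ 1 F)
    (hrad : Tendsto (BVOpt.objective K F β) (comap BVOpt.BV.norm atTop) atTop)
    (u : BVOpt.BV T d) :
    ContinuousOn (BVOpt.dualVar K F u) (Icc 0 T) ∧
    (IsMinOn (BVOpt.objective K F β) univ u ↔
      ((u.deriv ≠ 0 → BVOpt.cNorm T (BVOpt.dualVar K F u) = β) ∧
        (u.deriv = 0 → BVOpt.cNorm T (BVOpt.dualVar K F u) ≤ β)) ∧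
      BVOpt.dualVar K F u T = 0 ∧
      BVOpt.pairing (fun t : Ioo (0 : ℝ) T => BVOpt.dualVar K F u t) u.deriv =
        β * BVOpt.mNorm u.deriv) := by
  have hF : Differentiable ℝ F := hFdiff.differentiable (by simp)
  refine ⟨BVOpt.continuousOn_primitive hT _, fun hu => ?_, fun ⟨⟨h1, h2⟩, hpT, hpu⟩ => ?_⟩
  · have hpT := BVOpt.dualVar_apply_T_eq_zero hT hβ.le hF hu
    have hpu := BVOpt.pairing_dualVar_eq hT hβ.le hF hu
    obtain ⟨φ, hφ⟩ := BVOpt.exists_C0_primitive hT _ hpT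
    have hcφ := BVOpt.cNorm_eq hT (p := BVOpt.dualVar K F u) hφ
    have hle : ‖φ‖ ≤ β := BVOpt.norm_C0_le hβ.le fun t => by
      rw [hφ t]
      exact BVOpt.norm_dualVar_le hT hβ.le hF hu t
    refine ⟨⟨fun hne => ?_, fun _ => hcφ.trans_le hle⟩, hpT, hpu⟩
    rw [hcφ]
    -- From `β ‖u'‖ = ⟨p, u'⟩ ≤ ‖p‖ ‖u'‖`, divide by `‖u'‖ > 0`.
    refine hle.antisymm (le_of_mul_le_mul_right ?_ (BVOpt.mNorm_pos hne))
    rw [← hpu]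
    refine le_trans (le_of_eq ?_) (BVOpt.pairing_le φ u.deriv)
    exact congrArg (BVOpt.pairing · u.deriv) (funext fun t => (hφ t).symm)
  · refine BVOpt.isMinOn_of_dualVar hT hFconv.convexOn hF ?_ hpT hpu
    by_cases h : u.deriv = 0
    · exact h2 h
    · exact (h1 h).le
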